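/- Let $N\ge 3$, and let $\mathbb{B}^N$ be the Poincaré ball model of hyperbolic space, i.e. the open unit ball of $\mathbb{R}^N$ with the Riemannian metric $\rho^2\delta_{ij}$, where $\rho(x)=\frac{2}{1-|x|^2}$. Let $d(x)=\log\frac{1+|x|}{1-|x|}$ be the hyperbolic distance from $x$ to the origin, $\nabla_{\mathbb{B}^N}u=\rho^{-1}\nabla u$ the hyperbolic gradient, and $dV=\rho^N\,dx$ the hyperbolic volume element. For any real $a,b$ with $-\infty<a<\frac{N-2}{2}$ and $0\le b-a\le 1$, put $p=\frac{2N}{N-2+2(b-a)}$. Then there exists a constant $C=C(a,b,N)>0$ such that, for all real-valued $u\in C_c^\infty(\mathbb{B}^N)$, both integrals below are finite and $$\left(\int_{\mathbb{B}^N} d^{-bp}|u|^p\,dV\right)^{\frac2p}\le C\int_{\mathbb{B}^N} d^{-2a}|\nabla_{\mathbb{B}^N}u|^2\,dV .$$ -/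

import Mathlib

open scoped ContDiff

noncomputable section

namespace PoincareBall

/-- The underlying set of the Poincaré ball model: the open Euclidean unit ball of `ℝ^N`. -/
def ball (N : ℕ) : Set (EuclideanSpace ℝ (Fin N)) := Metric.ball 0 1

/-- The conformal factor `ρ(x) = 2 / (1 - |x|²)`; the Riemannian metric is `ρ² δ_{ij}`. -/
def rho {N : ℕ} (x : EuclideanSpace ℝ (Fin N)) : ℝ := 2 / (1 - ‖x‖ ^ 2)

/-- The hyperbolic distance of two points of the unit ball. -/
def hypDist {N : ℕ} (x y : EuclideanSpace ℝ (Fin N)) : ℝ :=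
  Real.arcosh (1 + 2 * ‖x - y‖ ^ 2 / ((1 - ‖x‖ ^ 2) * (1 - ‖y‖ ^ 2)))

/-- The hyperbolic distance from the origin. -/
def d {N : ℕ} (x : EuclideanSpace ℝ (Fin N)) : ℝ := hypDist 0 x

/-- The hyperbolic volume `dV = ρ^N dx` on the unit ball (as a measure on `ℝ^N` that does not
charge the complement of the ball). -/
def hypVolume (N : ℕ) : MeasureTheory.Measure (EuclideanSpace ℝ (Fin N)) :=
  (MeasureTheory.volume.restrict (ball N)).withDensity (fun x => ENNReal.ofReal (rho x ^ N))

/-- The hyperbolic gradient `∇u / ρ`. Its Euclidean norm `|∇u| / ρ` is the norm of `du` with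
respect to the metric `ρ² δ_{ij}`. -/
def hypGradient {N : ℕ} (u : EuclideanSpace ℝ (Fin N) → ℝ) (x : EuclideanSpace ℝ (Fin N)) :
    EuclideanSpace ℝ (Fin N) :=
  (rho x)⁻¹ • gradient u x

/-- `u ∈ C_c^∞` of the ball: `u` (extended by zero to `ℝ^N`) is smooth, with compact support
contained in the open unit ball. -/
structure IsTestFunction {N : ℕ} (u : EuclideanSpace ℝ (Fin N) → ℝ) : Prop where
  smooth : ContDiff ℝ ∞ u
  compact_support : HasCompactSupport u
  support_subset : tsupport u ⊆ ball N

/-- The closed form of the distance from the origin. -/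
theorem d_eq_log {N : ℕ} {x : EuclideanSpace ℝ (Fin N)} (hx : x ∈ ball N) :
    d x = Real.log ((1 + ‖x‖) / (1 - ‖x‖)) := by
  have h1 : ‖x‖ < 1 := by simpa [ball] using hx
  have h0 : 0 ≤ ‖x‖ := norm_nonneg x
  have hpos : 0 < 1 - ‖x‖ := by linarith
  have hpos' : 0 < 1 + ‖x‖ := by linarith
  have hq : 0 < (1 + ‖x‖) / (1 - ‖x‖) := div_pos hpos' hpos
  have hlog : 0 ≤ Real.log ((1 + ‖x‖) / (1 - ‖x‖)) := by
    apply Real.log_nonneg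
    rw [le_div_iff₀ hpos]
    linarith
  rw [← Real.arcosh_cosh hlog, Real.cosh_log hq]
  unfold d hypDist
  congr 1
  have h2 : 1 - ‖x‖ ^ 2 ≠ 0 := by nlinarith
  have h3 := hpos.ne'
  have h4 := hpos'.ne'
  simp only [zero_sub, norm_neg, norm_zero]
  have e : 1 - ‖x‖ ^ 2 = (1 - ‖x‖) * (1 + ‖x‖) := by ring
  rw [e, inv_div]
  norm_num
  field_simp
  ring

end PoincareBall

end

namespace PoincareBall

open MeasureTheory Set Filter Topology

noncomputable section

/-! Write `P = d^{-2a} ρ^N` and `q = 2N/(N-2)`. All weights are radial, so the claim is a weighted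
inequality on the Euclidean unit ball whose right side is `∫ P ρ^{-2} |∇u|² dx`. It follows by
Hölder from its two endpoints: Hardy (`b = a + 1`, `p = 2`) and Sobolev (`b = a`, `p = q`).

Hardy is proved with `coth² d` in place of the smaller `d^{-2}` (`hardy_inequality_of_punctured`).
The vector field `P (coth d / sinh d) x` has divergence at least `c P coth² d`, where `c = N - 2 - 2
max(a, 0) > 0` (`hardyWeight_le`), and its squared length is exactly the product of the Hardy and
energy densities (`sq_mul_fieldWeight`). Integrating the divergence of `u²` times this field and
absorbing the cross term gives the constant `4/c²`.

For the Sobolev endpoint put `w = d^{-a} ρ^{(N-2)/2} u`. The square of the multiplier is the energy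
density and its `q`-th power is `d^{-aq} ρ^N`, so the Euclidean Sobolev inequality for `w` has the
right left side. Differentiating the multiplier costs a term of order zero. The part coming from `ρ`
does not decay at infinity relative to the energy density, so `d^{-2}` could not control it, while
`coth² d ≥ 1` can; this is why the stronger Hardy inequality is needed.

These arguments need smooth weights, hence `u` vanishing near the origin. Cutoffs at scale `1/(n+1)`
remove this restriction: their gradient error is dominated by a multiple of `d^{-2a-2} u²`,
integrable because `2a + 2 < N`, and it tends to zero pointwise away from the origin. -/

/-- The hyperbolic distance from the origin as a function of the Euclidean radius. -/
def radialDist (r : ℝ) : ℝ := Real.log ((1 + r) / (1 - r))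

/-- The conformal factor as a function of the Euclidean radius. -/
def radialRho (r : ℝ) : ℝ := 2 / (1 - r ^ 2)

/-- The hyperbolic cotangent of the hyperbolic distance from the origin. -/
def radialCoth (r : ℝ) : ℝ := (1 + r ^ 2) / (2 * r)

/-! ### Calculus of the radial profiles. -/

section OneVariable

variable {r : ℝ}

lemma one_sub_sq_pos (h0 : 0 ≤ r) (h1 : r < 1) : 0 < 1 - r ^ 2 := by nlinarith

lemma radialRho_pos (h0 : 0 ≤ r) (h1 : r < 1) : 0 < radialRho r :=
  div_pos two_pos (one_sub_sq_pos h0 h1)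

lemma hasDerivAt_radialDist (h0 : 0 ≤ r) (h1 : r < 1) :
    HasDerivAt radialDist (radialRho r) r := by
  have hn : (1 - r : ℝ) ≠ 0 := by linarith
  have hp : (1 + r : ℝ) ≠ 0 := by linarith
  have h := (((hasDerivAt_id r).const_add 1).div ((hasDerivAt_id r).const_sub 1) hn).log
    (div_ne_zero hp hn)
  refine h.congr_deriv ?_
  have := (one_sub_sq_pos h0 h1).ne'
  simp only [radialRho, id, Pi.div_apply]
  have e : 1 - r ^ 2 = (1 - r) * (1 + r) := by ring
  rw [e]
  field_simp
  ring

lemma hasDerivAt_radialRho (h0 : 0 ≤ r) (h1 : r < 1) :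
    HasDerivAt radialRho (r * radialRho r ^ 2) r := by
  have hn := (one_sub_sq_pos h0 h1).ne'
  have h := (hasDerivAt_const r (2 : ℝ)).div ((hasDerivAt_pow 2 r).const_sub 1) hn
  refine h.congr_deriv ?_
  simp only [radialRho]
  field_simp
  ring

/-- The derivative `radialRho` of `radialDist` is at least `2`. -/
lemma two_mul_le_radialDist (h0 : 0 ≤ r) (h1 : r < 1) : 2 * r ≤ radialDist r := by
  have hanti : MonotoneOn (fun s => radialDist s - 2 * s) (Ico 0 1) := by
    apply monotoneOn_of_hasDerivWithinAt_nonneg (convex_Ico 0 1)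
      (f' := fun s => radialRho s - 2 * 1)
    · intro s hs
      exact ((hasDerivAt_radialDist hs.1 hs.2).continuousAt.sub
        (by fun_prop)).continuousWithinAt
    · intro s hs
      rw [interior_Ico] at hs
      exact ((hasDerivAt_radialDist hs.1.le hs.2).sub
        ((hasDerivAt_id s).const_mul 2)).hasDerivWithinAt
    · intro s hs
      rw [interior_Ico] at hs
      have := one_sub_sq_pos hs.1.le hs.2
      rw [sub_nonneg, radialRho, le_div_iff₀ this]
      nlinarith [sq_nonneg s]
  have := hanti (left_mem_Ico.2 one_pos) ⟨h0, h1⟩ h0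
  simp only [radialDist] at this ⊢
  norm_num at this
  linarith

lemma radialDist_pos (h0 : 0 < r) (h1 : r < 1) : 0 < radialDist r := by
  linarith [two_mul_le_radialDist h0.le h1]

lemma radialDist_nonneg (h0 : 0 ≤ r) (h1 : r < 1) : 0 ≤ radialDist r := by
  linarith [two_mul_le_radialDist h0 h1]

lemma radialDist_le (h0 : 0 ≤ r) (h1 : r < 1) : radialDist r ≤ 2 * r / (1 - r) := by
  have hn : 0 < 1 - r := by linarith
  refine (Real.log_le_sub_one_of_pos (div_pos (by linarith) hn)).trans (le_of_eq ?_)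
  field_simp
  ring

lemma one_le_radialCoth (h0 : 0 < r) : 1 ≤ radialCoth r := by
  rw [radialCoth, le_div_iff₀ (by positivity)]
  nlinarith [sq_nonneg (r - 1)]

lemma inv_radialDist_le_radialCoth (h0 : 0 < r) (h1 : r < 1) :
    (radialDist r)⁻¹ ≤ radialCoth r := by
  have h := two_mul_le_radialDist h0.le h1
  calc (radialDist r)⁻¹ ≤ (2 * r)⁻¹ := by gcongr
    _ ≤ radialCoth r := by
      rw [radialCoth, inv_eq_one_div]
      gcongr
      nlinarith

end OneVariable

/-! ### Regularity of the profiles away from the origin and the sphere. -/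

section Smoothness

lemma contDiffOn_radialDist : ContDiffOn ℝ 1 radialDist (Ioo 0 1) := by
  intro r hr
  have hn : (1 - r : ℝ) ≠ 0 := by linarith [hr.2]
  have hp : (1 + r : ℝ) ≠ 0 := by linarith [hr.1]
  exact (((contDiffAt_const.add contDiffAt_id).div (contDiffAt_const.sub contDiffAt_id) hn).log
    (div_ne_zero hp hn)).contDiffWithinAt

lemma contDiffOn_radialRho : ContDiffOn ℝ 1 radialRho (Ioo 0 1) := by
  intro r hr
  have h : ContDiffAt ℝ 1 (fun s : ℝ => 1 - s ^ 2) r := by fun_prop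
  exact (contDiffAt_const.div h (one_sub_sq_pos hr.1.le hr.2).ne').contDiffWithinAt

lemma contDiffOn_radialDist_rpow (s : ℝ) :
    ContDiffOn ℝ 1 (fun r => radialDist r ^ s) (Ioo 0 1) :=
  contDiffOn_radialDist.rpow_const_of_ne fun _ hr => (radialDist_pos hr.1 hr.2).ne'

lemma contDiffOn_radialRho_rpow (s : ℝ) :
    ContDiffOn ℝ 1 (fun r => radialRho r ^ s) (Ioo 0 1) :=
  contDiffOn_radialRho.rpow_const_of_ne fun _ hr => (radialRho_pos hr.1.le hr.2).ne'

end Smoothness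

/-! ### The weights and their pointwise inequalities. -/

section Weights

/-- The density in the gradient term. -/
def energyWeight (N : ℕ) (a r : ℝ) : ℝ :=
  radialDist r ^ (-2 * a) * radialRho r ^ N / radialRho r ^ 2

/-- The density in the Hardy term. -/
def hardyWeight (N : ℕ) (a r : ℝ) : ℝ :=
  radialDist r ^ (-2 * a) * radialRho r ^ N * radialCoth r ^ 2

/-- The profile of the radial vector field `x ↦ fieldWeight ‖x‖ • x` used to prove Hardy's
inequality. -/
def fieldWeight (N : ℕ) (a r : ℝ) : ℝ :=
  radialDist r ^ (-2 * a) * radialRho r ^ N * ((1 - r ^ 4) / (4 * r ^ 2))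

/-- The derivative of `fieldWeight`. -/
def fieldWeightDeriv (N : ℕ) (a r : ℝ) : ℝ :=
  radialDist r ^ (-2 * a) * radialRho r ^ N *
    ((-2 * a * radialRho r / radialDist r + N * r * radialRho r) * ((1 - r ^ 4) / (4 * r ^ 2))
      - (r + (1 - r ^ 4) / (2 * r ^ 3)))

/-- The multiplier that turns the energy into an unweighted Dirichlet integral. -/
def sobolevWeight (N : ℕ) (a r : ℝ) : ℝ :=
  radialDist r ^ (-a) * radialRho r ^ (((N : ℝ) - 2) / 2)

variable {N : ℕ} {a r : ℝ}

lemma contDiffOn_fieldWeight : ContDiffOn ℝ 1 (fieldWeight N a) (Ioo 0 1) := by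
  refine ((contDiffOn_radialDist_rpow _).mul (contDiffOn_radialRho.pow N)).mul ?_
  refine ContDiffOn.div (by fun_prop) (by fun_prop) fun r hr => ?_
  have := hr.1
  positivity

lemma contDiffOn_sobolevWeight : ContDiffOn ℝ 1 (sobolevWeight N a) (Ioo 0 1) :=
  (contDiffOn_radialDist_rpow _).mul (contDiffOn_radialRho_rpow _)

lemma continuousOn_hardyWeight : ContinuousOn (hardyWeight N a) (Ioo 0 1) := by
  refine ((contDiffOn_radialDist_rpow _).continuousOn.mul
    (contDiffOn_radialRho.continuousOn.pow N)).mul (ContinuousOn.pow ?_ 2)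
  refine ContinuousOn.div (by fun_prop) (by fun_prop) fun r hr => ?_
  have := hr.1
  positivity

lemma continuousOn_energyWeight : ContinuousOn (energyWeight N a) (Ioo 0 1) := by
  refine ContinuousOn.div ((contDiffOn_radialDist_rpow _).continuousOn.mul
    (contDiffOn_radialRho.continuousOn.pow N)) (contDiffOn_radialRho.continuousOn.pow 2)
      fun r hr => ?_
  have := radialRho_pos hr.1.le hr.2
  positivity

lemma hardyWeight_nonneg (h0 : 0 < r) (h1 : r < 1) : 0 ≤ hardyWeight N a r := by
  have := radialRho_pos h0.le h1
  have := radialDist_pos h0 h1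
  unfold hardyWeight
  positivity

lemma energyWeight_nonneg (h0 : 0 ≤ r) (h1 : r < 1) : 0 ≤ energyWeight N a r := by
  have := radialRho_pos h0 h1
  have := radialDist_nonneg h0 h1
  unfold energyWeight
  positivity

/-- With `coth d = (1+r²)/(2r)` and `1/sinh d = (1-r²)/(2r)`, the field has length `P coth d / ρ`.
The identity lets the cross term in Hardy's inequality split by AM-GM into the two densities. -/
lemma sq_mul_fieldWeight (h0 : 0 < r) (h1 : r < 1) :
    (r * fieldWeight N a r) ^ 2 = hardyWeight N a r * energyWeight N a r := by
  have := one_sub_sq_pos h0.le h1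
  have e : radialRho r ^ 2 = 4 / (1 - r ^ 2) ^ 2 := by rw [radialRho, div_pow]; norm_num
  simp only [hardyWeight, energyWeight, fieldWeight, radialCoth, e]
  field_simp
  ring

lemma hasDerivAt_fieldWeight (h0 : 0 < r) (h1 : r < 1) :
    HasDerivAt (fieldWeight N a) (fieldWeightDeriv N a r) r := by
  have hD := radialDist_pos h0 h1
  have hR := radialRho_pos h0.le h1
  have h1' := (hasDerivAt_radialDist h0.le h1).rpow_const (p := -2 * a) (Or.inl hD.ne')
  have h2' := (hasDerivAt_radialRho h0.le h1).pow N
  have h3' := ((hasDerivAt_pow 4 r).const_sub 1).div ((hasDerivAt_pow 2 r).const_mul 4)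
    (by positivity)
  refine ((h1'.mul h2').mul h3').congr_deriv ?_
  have hN : (N : ℝ) * radialRho r ^ (N - 1) * radialRho r = N * radialRho r ^ N := by
    rcases N with _ | n
    · simp
    · simp [pow_succ, mul_assoc]
  rw [Real.rpow_sub_one hD.ne']
  simp only [fieldWeightDeriv, Pi.mul_apply, Pi.div_apply, Pi.pow_apply]
  have : (N : ℝ) * radialRho r ^ (N - 1) * (r * radialRho r ^ 2)
      = N * radialRho r ^ N * (r * radialRho r) := by rw [← hN]; ring
  rw [this]
  push_cast
  field_simp
  ring

/-- The right side is the divergence of `x ↦ fieldWeight ‖x‖ • x`. After factoring out `P / (4r²)`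
the claim is polynomial in `r` and the ratio `2r/d`, which lies in `[0, 1]`. -/
lemma hardyWeight_le (h0 : 0 < r) (h1 : r < 1) :
    ((N : ℝ) - 2 - 2 * max a 0) * hardyWeight N a r ≤
      N * fieldWeight N a r + r * fieldWeightDeriv N a r := by
  have hD := radialDist_pos h0 h1
  have hR := radialRho_pos h0.le h1
  have hn := one_sub_sq_pos h0.le h1
  have hP : 0 ≤ radialDist r ^ (-2 * a) * radialRho r ^ N := by positivity
  have h2r := two_mul_le_radialDist h0.le h1
  set P := radialDist r ^ (-2 * a) * radialRho r ^ N with hPdef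
  set D := radialDist r
  have hrD : 0 ≤ 2 * r / D ∧ 2 * r / D ≤ 1 := ⟨by positivity, (div_le_one hD).2 h2r⟩
  have key : ((N : ℝ) - 2 - 2 * max a 0) * (1 + r ^ 2) ^ 2 ≤
      N * (1 + r ^ 2) ^ 2 - 2 * (1 + r ^ 4) - 2 * a * (2 * r / D) * (1 + r ^ 2) := by
    -- For `a < 0` this term helps but degenerates as `r → 1`, where `2r/d → 0`; it is dropped,
    -- hence `max a 0`.
    have ha : a * (2 * r / D) ≤ max a 0 := by
      calc a * (2 * r / D) ≤ max a 0 * (2 * r / D) := mul_le_mul_of_nonneg_right (le_max_left _ _) hrD.1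
        _ ≤ max a 0 * 1 := by gcongr; exact hrD.2
        _ = _ := mul_one _
    have hm : 0 ≤ max a 0 := le_max_right _ _
    have h3 : a * (2 * r / D) * (1 + r ^ 2) ≤ max a 0 * (1 + r ^ 2) := by gcongr
    have h4 : max a 0 * (1 + r ^ 2) ≤ max a 0 * (1 + r ^ 2) ^ 2 := by
      gcongr
      nlinarith [sq_nonneg r]
    nlinarith [sq_nonneg r]
  have e : N * fieldWeight N a r + r * fieldWeightDeriv N a r
      = P * ((N * (1 + r ^ 2) ^ 2 - 2 * (1 + r ^ 4) - 2 * a * (2 * r / D) * (1 + r ^ 2))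
        / (4 * r ^ 2)) := by
    simp only [fieldWeight, fieldWeightDeriv]
    have : radialRho r = 2 / (1 - r ^ 2) := rfl
    rw [this]
    change N * (P * _) + r * (P * ((-2 * a * _ / D + _) * _ - _)) = _
    field_simp
    ring
  rw [e]
  have e2 : ((N : ℝ) - 2 - 2 * max a 0) * hardyWeight N a r =
      P * (((N : ℝ) - 2 - 2 * max a 0) * (1 + r ^ 2) ^ 2 / (4 * r ^ 2)) := by
    simp only [hardyWeight, radialCoth]
    change _ * (P * _) = _
    field_simp
    ring
  rw [e2]
  gcongr

lemma sobolevWeight_pos (h0 : 0 < r) (h1 : r < 1) : 0 < sobolevWeight N a r := by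
  have := radialRho_pos h0.le h1
  have := radialDist_pos h0 h1
  unfold sobolevWeight
  positivity

lemma sobolevWeight_sq (h0 : 0 < r) (h1 : r < 1) :
    sobolevWeight N a r ^ 2 = energyWeight N a r := by
  have hR := radialRho_pos h0.le h1
  have hD := radialDist_pos h0 h1
  rw [sobolevWeight, energyWeight, mul_pow, ← Real.rpow_natCast, ← Real.rpow_natCast (_ ^ _),
    ← Real.rpow_mul hD.le, ← Real.rpow_mul hR.le, mul_div_assoc, ← Real.rpow_natCast _ N,
    ← Real.rpow_natCast _ 2, ← Real.rpow_sub hR]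
  push_cast
  congr 2 <;> ring

lemma sobolevWeight_rpow (hN : 3 ≤ N) (h0 : 0 < r) (h1 : r < 1) {q : ℝ}
    (hq : q = 2 * N / ((N : ℝ) - 2)) :
    sobolevWeight N a r ^ q = radialDist r ^ (-a * q) * radialRho r ^ N := by
  have hR := radialRho_pos h0.le h1
  have hD := radialDist_pos h0 h1
  have hN' : (3 : ℝ) ≤ N := by exact_mod_cast hN
  have : ((N : ℝ) - 2) / 2 * q = N := by
    have : (N : ℝ) - 2 ≠ 0 := by linarith
    rw [hq]; field_simp
  rw [sobolevWeight, Real.mul_rpow (by positivity) (by positivity), ← Real.rpow_mul hD.le,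
    ← Real.rpow_mul hR.le, this, Real.rpow_natCast]

/-- The derivative of `sobolevWeight`. -/
def sobolevWeightDeriv (N : ℕ) (a r : ℝ) : ℝ :=
  sobolevWeight N a r * (radialRho r * (-a / radialDist r + ((N : ℝ) - 2) / 2 * r))

lemma hasDerivAt_sobolevWeight (h0 : 0 < r) (h1 : r < 1) :
    HasDerivAt (sobolevWeight N a) (sobolevWeightDeriv N a r) r := by
  have hD := radialDist_pos h0 h1
  have hR := radialRho_pos h0.le h1
  have h1' := (hasDerivAt_radialDist h0.le h1).rpow_const (p := -a) (Or.inl hD.ne')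
  have h2' := (hasDerivAt_radialRho h0.le h1).rpow_const (p := ((N : ℝ) - 2) / 2) (Or.inl hR.ne')
  refine (h1'.mul h2').congr_deriv ?_
  rw [Real.rpow_sub_one hD.ne', Real.rpow_sub_one hR.ne']
  simp only [sobolevWeightDeriv, sobolevWeight]
  field_simp

/-- The logarithmic derivative of the multiplier is `ρ (-a/d + (N-2) r/2)`; both `1/d` and `r` are
at most `coth d`, and `ρ²` turns the energy density into the Hardy density. -/
lemma sobolevWeightDeriv_sq_le (hN : 3 ≤ N) (h0 : 0 < r) (h1 : r < 1) :
    sobolevWeightDeriv N a r ^ 2 ≤ (|a| + N) ^ 2 * hardyWeight N a r := by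
  have hD := radialDist_pos h0 h1
  have hR := radialRho_pos h0.le h1
  have hK := one_le_radialCoth h0
  have hN' : (3 : ℝ) ≤ N := by exact_mod_cast hN
  have hi := inv_radialDist_le_radialCoth h0 h1
  rw [sobolevWeightDeriv, mul_pow, sobolevWeight_sq h0 h1, mul_pow]
  have hb : |(-a / radialDist r + ((N : ℝ) - 2) / 2 * r)| ≤ (|a| + N) * radialCoth r := by
    calc |(-a / radialDist r + ((N : ℝ) - 2) / 2 * r)|
        ≤ |(-a / radialDist r)| + |((N : ℝ) - 2) / 2 * r| := abs_add_le _ _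
      _ = |a| * (radialDist r)⁻¹ + ((N : ℝ) - 2) / 2 * r := by
        rw [abs_div, abs_neg, abs_of_pos hD, 
          abs_of_nonneg (a := ((N : ℝ) - 2) / 2 * r) (by apply mul_nonneg <;> linarith),
          div_eq_mul_inv]
      _ ≤ |a| * radialCoth r + N * radialCoth r := by gcongr <;> linarith
      _ = _ := by ring
  have hsq : (-a / radialDist r + ((N : ℝ) - 2) / 2 * r) ^ 2 ≤ ((|a| + N) * radialCoth r) ^ 2 :=
    sq_le_sq' (abs_le.1 hb).1 (abs_le.1 hb).2
  have hE := energyWeight_nonneg (N := N) (a := a) h0.le h1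
  calc energyWeight N a r * (radialRho r ^ 2 * (-a / radialDist r + ((N : ℝ) - 2) / 2 * r) ^ 2)
      ≤ energyWeight N a r * (radialRho r ^ 2 * ((|a| + N) * radialCoth r) ^ 2) := by gcongr
    _ = _ := by
      simp only [energyWeight, hardyWeight]
      field_simp

end Weights

/-! ### The divergence theorem for fields `f x • x`. -/

section Euler

variable {N : ℕ}

/-- The integral of the divergence of `x ↦ f x • x` vanishes. -/
lemma integral_euler_eq_zero {f : EuclideanSpace ℝ (Fin N) → ℝ} (hf : ContDiff ℝ 1 f)
    (hc : HasCompactSupport f) :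
    ∫ x, (N * f x + fderiv ℝ f x x) = 0 := by
  have hfd : Continuous (fderiv ℝ f) := hf.continuous_fderiv one_ne_zero
  have hcd : HasCompactSupport (fderiv ℝ f) := hc.fderiv ℝ
  have hi (i : Fin N) : ∫ x : EuclideanSpace ℝ (Fin N),
      x i * fderiv ℝ f x (EuclideanSpace.single i 1) = - ∫ x, f x := by
    have hline (x : EuclideanSpace ℝ (Fin N)) :
        fderiv ℝ (fun y : EuclideanSpace ℝ (Fin N) => y i) x (EuclideanSpace.single i 1) = 1 := by
      have : (fun y : EuclideanSpace ℝ (Fin N) => y i)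
          = (EuclideanSpace.proj i : EuclideanSpace ℝ (Fin N) →L[ℝ] ℝ) := rfl
      rw [this, ContinuousLinearMap.fderiv]
      simp
    -- Integration by parts against the coordinate `x i`, whose derivative in direction `i` is `1`;
    -- summing over `i` produces the term `N * f`.
    rw [integral_mul_fderiv_eq_neg_fderiv_mul_of_integrable]
    · simp only [hline, one_mul]
    · simp only [hline, one_mul]
      exact hf.continuous.integrable_of_hasCompactSupport hc
    · apply Continuous.integrable_of_hasCompactSupport (by fun_prop)
      exact (hcd.comp_left (g := fun L : EuclideanSpace ℝ (Fin N) →L[ℝ] ℝ =>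
        L (EuclideanSpace.single i 1)) rfl).mul_left
    · exact Continuous.integrable_of_hasCompactSupport (by fun_prop) hc.mul_left
    · intro x _
      fun_prop
    · intro x _
      exact (hf.differentiable one_ne_zero) x
  have hsum (x : EuclideanSpace ℝ (Fin N)) :
      fderiv ℝ f x x = ∑ i, x i * fderiv ℝ f x (EuclideanSpace.single i 1) := by
    have h := congrArg (fderiv ℝ f x) ((EuclideanSpace.basisFun (Fin N) ℝ).sum_repr x)
    rw [← h]
    simp
  have hInt (i : Fin N) : Integrable fun x : EuclideanSpace ℝ (Fin N) =>
      x i * fderiv ℝ f x (EuclideanSpace.single i 1) := by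
    apply Continuous.integrable_of_hasCompactSupport (by fun_prop)
    exact (hcd.comp_left (g := fun L : EuclideanSpace ℝ (Fin N) →L[ℝ] ℝ =>
      L (EuclideanSpace.single i 1)) rfl).mul_left
  simp only [hsum]
  rw [integral_add, integral_const_mul, integral_finsetSum _ fun i _ => hInt i]
  · simp [hi]
  · exact (hf.continuous.integrable_of_hasCompactSupport hc).const_mul _
  · exact integrable_finsetSum _ fun i _ => hInt i

end Euler

/-! ### Radial weights times functions supported in the punctured ball. -/

section Radial

variable {N : ℕ}

/-- The punctured unit ball. -/
def puncturedBall (N : ℕ) : Set (EuclideanSpace ℝ (Fin N)) := {x | ‖x‖ ∈ Ioo (0 : ℝ) 1}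

lemma differentiableAt_norm_of_mem {x : EuclideanSpace ℝ (Fin N)} (hx : x ∈ puncturedBall N) :
    DifferentiableAt ℝ (fun y : EuclideanSpace ℝ (Fin N) => ‖y‖) x :=
  (contDiffAt_norm ℝ (n := 1) (norm_pos_iff.1 hx.1)).differentiableAt one_ne_zero

lemma hasFDerivAt_radial {φ : ℝ → ℝ} {φ' : ℝ} {x : EuclideanSpace ℝ (Fin N)}
    (hx : x ∈ puncturedBall N) (hφ : HasDerivAt φ φ' ‖x‖) :
    HasFDerivAt (fun y => φ ‖y‖) (φ' • fderiv ℝ (fun y : EuclideanSpace ℝ (Fin N) => ‖y‖) x) x :=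
  hφ.comp_hasFDerivAt x (differentiableAt_norm_of_mem hx).hasFDerivAt

lemma norm_fderiv_norm_le (x : EuclideanSpace ℝ (Fin N)) :
    ‖fderiv ℝ (fun y : EuclideanSpace ℝ (Fin N) => ‖y‖) x‖ ≤ 1 :=
  NNReal.coe_one ▸ norm_fderiv_le_of_lipschitz ℝ lipschitzWith_one_norm

lemma contDiff_radial_mul {φ : ℝ → ℝ} (hφ : ContDiffOn ℝ 1 φ (Ioo 0 1))
    {f : EuclideanSpace ℝ (Fin N) → ℝ} (hf : ContDiff ℝ 1 f)
    (hs : tsupport f ⊆ puncturedBall N) : ContDiff ℝ 1 fun x => φ ‖x‖ * f x := by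
  rw [contDiff_iff_contDiffAt]
  intro x
  by_cases hx : x ∈ tsupport f
  swap
  · refine contDiffAt_const.congr_of_eventuallyEq (f := fun _ => (0 : ℝ)) ?_
    filter_upwards [(isClosed_tsupport f).isOpen_compl.mem_nhds hx] with y hy
    rw [image_eq_zero_of_notMem_tsupport hy, mul_zero]
  have hx' : x ∈ puncturedBall N := hs hx
  exact ((hφ.contDiffAt (isOpen_Ioo.mem_nhds hx')).comp x
    (contDiffAt_norm ℝ (norm_pos_iff.1 hx'.1))).mul hf.contDiffAt

lemma continuous_radial_mul {φ : ℝ → ℝ} (hφ : ContinuousOn φ (Ioo 0 1))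
    {f : EuclideanSpace ℝ (Fin N) → ℝ} (hf : Continuous f)
    (hs : tsupport f ⊆ puncturedBall N) : Continuous fun x => φ ‖x‖ * f x := by
  refine continuous_of_tsupport fun x hx => ?_
  have hx' : x ∈ puncturedBall N := hs (tsupport_mul_subset_right hx)
  exact (ContinuousAt.comp (f := fun y : EuclideanSpace ℝ (Fin N) => ‖y‖)
    (hφ.continuousAt (isOpen_Ioo.mem_nhds hx')) continuous_norm.continuousAt).mul hf.continuousAt

lemma integrable_radial_mul {φ : ℝ → ℝ} (hφ : ContinuousOn φ (Ioo 0 1))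
    {f : EuclideanSpace ℝ (Fin N) → ℝ} (hf : Continuous f) (hc : HasCompactSupport f)
    (hs : tsupport f ⊆ puncturedBall N) : Integrable fun x => φ ‖x‖ * f x :=
  (continuous_radial_mul hφ hf hs).integrable_of_hasCompactSupport hc.mul_left

end Radial

/-! ### Hardy's inequality with the weight `coth² d`. -/

section Hardy

variable {N : ℕ} {a : ℝ} {u : EuclideanSpace ℝ (Fin N) → ℝ}

lemma integrable_hardyWeight (hu : ContDiff ℝ 1 u) (hc : HasCompactSupport u)
    (hs : tsupport u ⊆ puncturedBall N) : Integrable fun x => hardyWeight N a ‖x‖ * u x ^ 2 := by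
  have h2 : (fun x => u x ^ 2) = fun x => u x * u x := by ext; ring
  have hc2 : HasCompactSupport fun x => u x ^ 2 := by rw [h2]; exact hc.mul_left
  refine integrable_radial_mul continuousOn_hardyWeight (hu.continuous.pow 2) hc2 ?_
  rw [h2]
  exact (tsupport_mul_subset_right).trans hs

lemma tsupport_norm_fderiv_sq_subset :
    tsupport (fun x => ‖fderiv ℝ u x‖ ^ 2) ⊆ tsupport u := by
  refine (closure_mono ?_).trans (tsupport_fderiv_subset ℝ (f := u))
  intro x hx hx'
  simp [hx'] at hx

lemma integrable_energyWeight (hu : ContDiff ℝ 1 u) (hc : HasCompactSupport u)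
    (hs : tsupport u ⊆ puncturedBall N) :
    Integrable fun x => energyWeight N a ‖x‖ * ‖fderiv ℝ u x‖ ^ 2 := by
  have hfd : Continuous (fderiv ℝ u) := hu.continuous_fderiv one_ne_zero
  exact integrable_radial_mul continuousOn_energyWeight (by fun_prop)
    ((hc.fderiv ℝ).comp_left (g := fun L : EuclideanSpace ℝ (Fin N) →L[ℝ] ℝ => ‖L‖ ^ 2) (by simp))
    (tsupport_norm_fderiv_sq_subset.trans hs)

/-- Weighted Hardy inequality away from the origin. -/
theorem hardy_inequality_of_punctured (ha : 0 < (N : ℝ) - 2 - 2 * max a 0) (hu : ContDiff ℝ 1 u)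
    (hc : HasCompactSupport u) (hs : tsupport u ⊆ puncturedBall N) :
    ∫ x, hardyWeight N a ‖x‖ * u x ^ 2 ≤
      4 / ((N : ℝ) - 2 - 2 * max a 0) ^ 2 *
        ∫ x, energyWeight N a ‖x‖ * ‖fderiv ℝ u x‖ ^ 2 := by
  set c := (N : ℝ) - 2 - 2 * max a 0
  have hH := integrable_hardyWeight (a := a) hu hc hs
  have hE := integrable_energyWeight (a := a) hu hc hs
  set f : EuclideanSpace ℝ (Fin N) → ℝ := fun x => fieldWeight N a ‖x‖ * (u x * u x) with hfdef
  have hf : ContDiff ℝ 1 f :=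
    contDiff_radial_mul contDiffOn_fieldWeight (hu.mul hu) (tsupport_mul_subset_right.trans hs)
  have hcf : HasCompactSupport f := (hc.mul_left).mul_left
  have hfd : Continuous (fderiv ℝ f) := hf.continuous_fderiv one_ne_zero
  have hEuler := integral_euler_eq_zero hf hcf
  have hEint : Integrable fun x => (N * f x + fderiv ℝ f x x) := by
    refine Continuous.integrable_of_hasCompactSupport (by fun_prop) ?_
    refine hcf.mul_left.add ?_
    refine (hcf.fderiv ℝ).mono ?_
    intro x hx hx'
    simp [hx'] at hx
  have hpt (x) : c / 2 * (hardyWeight N a ‖x‖ * u x ^ 2) ≤ (N * f x + fderiv ℝ f x x) +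
      2 / c * (energyWeight N a ‖x‖ * ‖fderiv ℝ u x‖ ^ 2) := by
    by_cases hx : x ∈ tsupport u
    · have hxB := hs hx
      obtain ⟨h0, h1⟩ := hxB
      have hud : HasFDerivAt u (fderiv ℝ u x) x := (hu.differentiable one_ne_zero x).hasFDerivAt
      have hder := (hasFDerivAt_radial (hs hx) (hasDerivAt_fieldWeight (N := N) (a := a) h0 h1)).mul
        (hud.mul hud)
      have hval : fderiv ℝ f x x = ‖x‖ * fieldWeightDeriv N a ‖x‖ * u x ^ 2
          + 2 * fieldWeight N a ‖x‖ * u x * fderiv ℝ u x x := by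
        rw [(show HasFDerivAt f _ x from hder).fderiv]
        simp only [_root_.add_apply, _root_.smul_apply, smul_eq_mul,
          (differentiableAt_norm_of_mem (hs hx)).fderiv_norm_self, Pi.mul_apply]
        ring
      rw [hval]
      have h4 := mul_le_mul_of_nonneg_right (hardyWeight_le (N := N) (a := a) h0 h1)
        (sq_nonneg (u x))
      have hHn := hardyWeight_nonneg (N := N) (a := a) h0 h1
      have hEn := energyWeight_nonneg (N := N) (a := a) h0.le h1
      have hsq := sq_mul_fieldWeight (N := N) (a := a) h0 h1
      have hxx : |fderiv ℝ u x x| ≤ ‖fderiv ℝ u x‖ * ‖x‖ := (fderiv ℝ u x).le_opNorm x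
      -- AM-GM for the cross term. The factors `c/2` and `2/c` cancel in `A * B`, and `c/2` leaves
      -- half of the divergence bound on the left.
      have h5 : -(2 * fieldWeight N a ‖x‖ * u x * fderiv ℝ u x x) ≤
          c / 2 * (hardyWeight N a ‖x‖ * u x ^ 2) +
          2 / c * (energyWeight N a ‖x‖ * ‖fderiv ℝ u x‖ ^ 2) := by
        set A := c / 2 * (hardyWeight N a ‖x‖ * u x ^ 2)
        set B := 2 / c * (energyWeight N a ‖x‖ * ‖fderiv ℝ u x‖ ^ 2)
        have hA : 0 ≤ A := by positivity
        have hB : 0 ≤ B := by positivity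
        have hAB : A * B = (‖x‖ * fieldWeight N a ‖x‖) ^ 2 * u x ^ 2 * ‖fderiv ℝ u x‖ ^ 2 := by
          rw [hsq]
          simp only [A, B]
          field_simp
        have hx2 : (fderiv ℝ u x x) ^ 2 ≤ (‖fderiv ℝ u x‖ * ‖x‖) ^ 2 :=
          sq_le_sq' (abs_le.1 hxx).1 (abs_le.1 hxx).2
        have : (-(2 * fieldWeight N a ‖x‖ * u x * fderiv ℝ u x x)) ^ 2 ≤ (A + B) ^ 2 := by
          calc (-(2 * fieldWeight N a ‖x‖ * u x * fderiv ℝ u x x)) ^ 2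
              = 4 * (fieldWeight N a ‖x‖ * u x) ^ 2 * (fderiv ℝ u x x) ^ 2 := by ring
            _ ≤ 4 * (fieldWeight N a ‖x‖ * u x) ^ 2 * (‖fderiv ℝ u x‖ * ‖x‖) ^ 2 := by gcongr
            _ = 4 * (A * B) := by rw [hAB]; ring
            _ ≤ (A + B) ^ 2 := by nlinarith [sq_nonneg (A - B)]
        exact (le_abs_self _).trans (abs_le_of_sq_le_sq this (by positivity))
      simp only [hfdef]
      linarith
    · have h0 : u x = 0 := image_eq_zero_of_notMem_tsupport hx
      have h1 : fderiv ℝ u x = 0 :=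
        image_eq_zero_of_notMem_tsupport fun h => hx (tsupport_fderiv_subset ℝ h)
      have h2 : fderiv ℝ f x = 0 :=
        image_eq_zero_of_notMem_tsupport fun h => hx
          (tsupport_mul_subset_right (tsupport_mul_subset_right (tsupport_fderiv_subset ℝ h)))
      simp [hfdef, h0, h1]
      simp [hfdef] at h2
      simp [h2]
  have hmain := integral_mono (hH.const_mul (c / 2)) (hEint.add (hE.const_mul (2 / c))) hpt
  simp only [Pi.add_apply] at hmain
  rw [integral_const_mul, integral_add hEint (hE.const_mul (2 / c)), hEuler, zero_add,
    integral_const_mul] at hmain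
  have : ∫ x, hardyWeight N a ‖x‖ * u x ^ 2 =
      2 / c * (c / 2 * ∫ x, hardyWeight N a ‖x‖ * u x ^ 2) := by field_simp
  rw [this]
  calc _ ≤ 2 / c * (2 / c * ∫ x, energyWeight N a ‖x‖ * ‖fderiv ℝ u x‖ ^ 2) := by gcongr
    _ = _ := by ring_nf

end Hardy

/-! ### The Euclidean Sobolev inequality. -/

section Sobolev

variable {N : ℕ}

/-- The Sobolev inequality in `ℝ^N` for real integrals. -/
theorem exists_sobolev_const (hN : 3 ≤ N) {q : ℝ} (hq : q = 2 * N / ((N : ℝ) - 2)) :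
    ∃ S : ℝ, 0 ≤ S ∧ ∀ w : EuclideanSpace ℝ (Fin N) → ℝ, ContDiff ℝ 1 w → HasCompactSupport w →
      (∫ x, |w x| ^ q) ^ (2 / q) ≤ S * ∫ x, ‖fderiv ℝ w x‖ ^ 2 := by
  have hN' : (3 : ℝ) ≤ N := by exact_mod_cast hN
  have hN2 : (0 : ℝ) < N - 2 := by linarith
  have hq0 : 0 < q := by rw [hq]; positivity
  set K := eLpNormLESNormFDerivOfEqInnerConst
    (volume : Measure (EuclideanSpace ℝ (Fin N))) ((2 : NNReal) : ℝ)
  refine ⟨(K : ℝ) ^ 2, by positivity, fun w hw hc => ?_⟩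
  have hfd : Continuous (fderiv ℝ w) := hw.continuous_fderiv one_ne_zero
  obtain ⟨q', hq'⟩ : ∃ q' : NNReal, (q' : ℝ) = q := ⟨⟨q, hq0.le⟩, rfl⟩
  have h := eLpNorm_le_eLpNorm_fderiv_of_eq_inner
    (volume : Measure (EuclideanSpace ℝ (Fin N))) hw hc (p := 2) (p' := q')
    (by norm_num) (by simp; omega) (by
      simp only [finrank_euclideanSpace, Fintype.card_fin, hq', hq]
      push_cast
      field_simp)
  change eLpNorm w q' volume ≤ (K : ENNReal) * _ at h
  have hm : MemLp w (q' : ENNReal) volume :=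
    hw.continuous.memLp_of_hasCompactSupport hc
  have hm2 : MemLp (fderiv ℝ w) ((2 : NNReal) : ENNReal) volume :=
    hfd.memLp_of_hasCompactSupport (hc.fderiv ℝ)
  rw [hm.eLpNorm_eq_integral_rpow_norm (by simpa [← NNReal.coe_eq_zero, hq'] using hq0.ne') (by simp),
    hm2.eLpNorm_eq_integral_rpow_norm (by simp) (by simp), ← ENNReal.ofReal_coe_nnreal (p := K),
    ← ENNReal.ofReal_mul (by positivity), ENNReal.ofReal_le_ofReal_iff (by positivity)] at h
  simp only [ENNReal.coe_toReal, hq', Real.norm_eq_abs, NNReal.coe_ofNat,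
    Real.rpow_ofNat] at h
  have hI : 0 ≤ ∫ x, |w x| ^ q := integral_nonneg fun x => by positivity
  have hJ : 0 ≤ ∫ x, ‖fderiv ℝ w x‖ ^ 2 := integral_nonneg fun x => by positivity
  calc (∫ x, |w x| ^ q) ^ (2 / q) = ((∫ x, |w x| ^ q) ^ q⁻¹) ^ 2 := by
        rw [← Real.rpow_natCast, ← Real.rpow_mul hI]
        congr 1
        push_cast
        ring
    _ ≤ (K * (∫ x, ‖fderiv ℝ w x‖ ^ 2) ^ (2 : ℝ)⁻¹) ^ 2 := by
        gcongr
    _ = _ := by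
        rw [mul_pow, ← Real.rpow_natCast (_ ^ _), ← Real.rpow_mul hJ]
        norm_num

end Sobolev

/-! ### The Sobolev endpoint `b = a`. -/

section HardySobolev

variable {N : ℕ} {a : ℝ} {u : EuclideanSpace ℝ (Fin N) → ℝ}

/-- Product rule and `(s + t)² ≤ 2s² + 2t²`; the second term is what Hardy's inequality absorbs. -/
lemma norm_fderiv_sobolevWeight_mul_sq_le (hN : 3 ≤ N) (hu : ContDiff ℝ 1 u)
    (hs : tsupport u ⊆ puncturedBall N) (x : EuclideanSpace ℝ (Fin N)) :
    ‖fderiv ℝ (fun y => sobolevWeight N a ‖y‖ * u y) x‖ ^ 2 ≤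
      2 * (energyWeight N a ‖x‖ * ‖fderiv ℝ u x‖ ^ 2) +
        2 * (|a| + N) ^ 2 * (hardyWeight N a ‖x‖ * u x ^ 2) := by
  by_cases hx : x ∈ tsupport u
  · have hxB := hs hx
    obtain ⟨h0, h1⟩ := hxB
    have hud : HasFDerivAt u (fderiv ℝ u x) x := (hu.differentiable one_ne_zero x).hasFDerivAt
    have hder := (hasFDerivAt_radial (hs hx) (hasDerivAt_sobolevWeight (N := N) (a := a) h0 h1)).mul
      hud
    rw [(show HasFDerivAt (fun y => sobolevWeight N a ‖y‖ * u y) _ x from hder).fderiv]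
    have hn : ‖sobolevWeight N a ‖x‖ • fderiv ℝ u x + u x • sobolevWeightDeriv N a ‖x‖ •
        fderiv ℝ (fun y : EuclideanSpace ℝ (Fin N) => ‖y‖) x‖ ≤
        |sobolevWeight N a ‖x‖| * ‖fderiv ℝ u x‖ + |u x| * |sobolevWeightDeriv N a ‖x‖| := by
      refine (norm_add_le _ _).trans ?_
      rw [norm_smul, norm_smul, norm_smul, Real.norm_eq_abs, Real.norm_eq_abs, Real.norm_eq_abs]
      gcongr
      exact mul_le_of_le_one_right (abs_nonneg _) (norm_fderiv_norm_le x)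
    calc _ ≤ (|sobolevWeight N a ‖x‖| * ‖fderiv ℝ u x‖ +
            |u x| * |sobolevWeightDeriv N a ‖x‖|) ^ 2 := by gcongr
      _ ≤ 2 * ((|sobolevWeight N a ‖x‖| * ‖fderiv ℝ u x‖) ^ 2 +
            (|u x| * |sobolevWeightDeriv N a ‖x‖|) ^ 2) := add_sq_le
      _ = 2 * (energyWeight N a ‖x‖ * ‖fderiv ℝ u x‖ ^ 2) +
            2 * (sobolevWeightDeriv N a ‖x‖ ^ 2) * u x ^ 2 := by
          rw [mul_pow, mul_pow, sq_abs, sq_abs, sq_abs, sobolevWeight_sq h0 h1]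
          ring
      _ ≤ 2 * (energyWeight N a ‖x‖ * ‖fderiv ℝ u x‖ ^ 2) +
            2 * ((|a| + N) ^ 2 * hardyWeight N a ‖x‖) * u x ^ 2 := by
          gcongr
          exact sobolevWeightDeriv_sq_le hN h0 h1
      _ = _ := by ring
  · have h0 : u x = 0 := image_eq_zero_of_notMem_tsupport hx
    have h1 : fderiv ℝ u x = 0 :=
      image_eq_zero_of_notMem_tsupport fun h => hx (tsupport_fderiv_subset ℝ h)
    have h2 : fderiv ℝ (fun y => sobolevWeight N a ‖y‖ * u y) x = 0 :=
      image_eq_zero_of_notMem_tsupport fun h => hx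
        (tsupport_mul_subset_right (tsupport_fderiv_subset ℝ h))
    simp [h0, h1, h2]

/-- The endpoint `b = a` away from the origin. -/
theorem exists_hardySobolev_const_of_punctured (hN : 3 ≤ N)
    (ha : 0 < (N : ℝ) - 2 - 2 * max a 0) {q : ℝ} (hq : q = 2 * N / ((N : ℝ) - 2)) :
    ∃ C : ℝ, 0 ≤ C ∧ ∀ u : EuclideanSpace ℝ (Fin N) → ℝ, ContDiff ℝ 1 u → HasCompactSupport u →
      tsupport u ⊆ puncturedBall N →
      (∫ x, radialDist ‖x‖ ^ (-a * q) * radialRho ‖x‖ ^ N * |u x| ^ q) ^ (2 / q) ≤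
        C * ∫ x, energyWeight N a ‖x‖ * ‖fderiv ℝ u x‖ ^ 2 := by
  obtain ⟨S, hS, hSob⟩ := exists_sobolev_const hN hq
  have hN' : (3 : ℝ) ≤ N := by exact_mod_cast hN
  have hN2 : (0 : ℝ) < N - 2 := by linarith
  have hq0 : 0 < q := by rw [hq]; positivity
  set c := (N : ℝ) - 2 - 2 * max a 0
  refine ⟨S * (2 + 2 * (|a| + N) ^ 2 * (4 / c ^ 2)), by positivity, fun u hu hc hs => ?_⟩
  have hw : ContDiff ℝ 1 fun x => sobolevWeight N a ‖x‖ * u x :=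
    contDiff_radial_mul contDiffOn_sobolevWeight hu hs
  have hcw : HasCompactSupport fun x => sobolevWeight N a ‖x‖ * u x := hc.mul_left
  have h1 := hSob _ hw hcw
  have hH := integrable_hardyWeight (a := a) hu hc hs
  have hE := integrable_energyWeight (a := a) hu hc hs
  have hfd : Continuous (fderiv ℝ fun x => sobolevWeight N a ‖x‖ * u x) :=
    hw.continuous_fderiv one_ne_zero
  have hI : Integrable fun x => ‖fderiv ℝ (fun y => sobolevWeight N a ‖y‖ * u y) x‖ ^ 2 :=
    Continuous.integrable_of_hasCompactSupport (by fun_prop) ((hcw.fderiv ℝ).comp_left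
      (g := fun L : EuclideanSpace ℝ (Fin N) →L[ℝ] ℝ => ‖L‖ ^ 2) (by simp))
  have h2 := integral_mono hI ((hE.const_mul 2).add (hH.const_mul (2 * (|a| + N) ^ 2)))
    (norm_fderiv_sobolevWeight_mul_sq_le hN hu hs)
  simp only [Pi.add_apply] at h2
  rw [integral_add (hE.const_mul 2) (hH.const_mul (2 * (|a| + N) ^ 2)), integral_const_mul,
    integral_const_mul] at h2
  have h3 := hardy_inequality_of_punctured ha hu hc hs
  have h4 : ∫ x, |sobolevWeight N a ‖x‖ * u x| ^ q =
      ∫ x, radialDist ‖x‖ ^ (-a * q) * radialRho ‖x‖ ^ N * |u x| ^ q := by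
    congr 1
    ext x
    by_cases hx : x ∈ tsupport u
    · obtain ⟨hx0, hx1⟩ := hs hx
      rw [abs_mul, Real.mul_rpow (abs_nonneg _) (abs_nonneg _),
        abs_of_pos (sobolevWeight_pos hx0 hx1), sobolevWeight_rpow hN hx0 hx1 hq]
    · simp [image_eq_zero_of_notMem_tsupport hx, Real.zero_rpow hq0.ne']
  rw [← h4]
  calc _ ≤ _ := h1
    _ ≤ S * (2 * (∫ x, energyWeight N a ‖x‖ * ‖fderiv ℝ u x‖ ^ 2) + 2 * (|a| + N) ^ 2 *
        (4 / c ^ 2 * ∫ x, energyWeight N a ‖x‖ * ‖fderiv ℝ u x‖ ^ 2)) := by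
      refine mul_le_mul_of_nonneg_left (h2.trans ?_) hS
      gcongr
    _ = _ := by ring

end HardySobolev

/-! ### Hölder interpolation between the Hardy and Sobolev endpoints. -/

section Interpolation

/-- Hölder's inequality for a geometric mean of two integrable functions. -/
lemma integral_rpow_mul_rpow_le {α : Type*} [MeasurableSpace α] {μ : Measure α} {f g : α → ℝ}
    (hf : Integrable f μ) (hg : Integrable g μ) (hf0 : 0 ≤ f) (hg0 : 0 ≤ g) {s t : ℝ}
    (hs : 0 ≤ s) (ht : 0 ≤ t) (hst : s + t = 1) :
    ∫ x, f x ^ s * g x ^ t ∂μ ≤ (∫ x, f x ∂μ) ^ s * (∫ x, g x ∂μ) ^ t := by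
  have hIf : 0 ≤ ∫ x, f x ∂μ := integral_nonneg hf0
  have hIg : 0 ≤ ∫ x, g x ∂μ := integral_nonneg hg0
  have h := ENNReal.lintegral_mul_norm_pow_le (μ := μ) hf.aemeasurable.ennreal_ofReal
    hg.aemeasurable.ennreal_ofReal hs ht hst
  rw [← ofReal_integral_eq_lintegral_ofReal hf (Eventually.of_forall hf0),
    ← ofReal_integral_eq_lintegral_ofReal hg (Eventually.of_forall hg0),
    ENNReal.ofReal_rpow_of_nonneg hIf hs, ENNReal.ofReal_rpow_of_nonneg hIg ht,
    ← ENNReal.ofReal_mul (by positivity)] at h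
  rw [integral_eq_lintegral_of_nonneg_ae
    (Eventually.of_forall fun x => mul_nonneg (Real.rpow_nonneg (hf0 x) _)
      (Real.rpow_nonneg (hg0 x) _))
    ((hf.aemeasurable.pow_const s).mul (hg.aemeasurable.pow_const t)).aestronglyMeasurable]
  refine ENNReal.toReal_le_of_le_ofReal (by positivity) (le_trans (le_of_eq ?_) h)
  refine lintegral_congr fun x => ?_
  rw [ENNReal.ofReal_mul (Real.rpow_nonneg (hf0 x) _), ENNReal.ofReal_rpow_of_nonneg (hf0 x) hs,
    ENNReal.ofReal_rpow_of_nonneg (hg0 x) ht]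

variable {N : ℕ} {a b p : ℝ}

lemma continuousOn_radialDist_rpow_mul (s : ℝ) :
    ContinuousOn (fun r => radialDist r ^ s * radialRho r ^ N) (Ioo 0 1) :=
  (contDiffOn_radialDist_rpow s).continuousOn.mul (contDiffOn_radialRho.continuousOn.pow N)

lemma tsupport_abs_rpow_subset {u : EuclideanSpace ℝ (Fin N) → ℝ} {q : ℝ} (hq : 0 < q) :
    tsupport (fun x => |u x| ^ q) ⊆ tsupport u := by
  refine closure_mono fun x hx hx' => ?_
  simp [hx', Real.zero_rpow hq.ne'] at hx

/-- The inequality for functions vanishing near the origin. -/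
theorem exists_const_of_punctured (hN : 3 ≤ N)
    (ha : 0 < (N : ℝ) - 2 - 2 * max a 0) (hab₀ : 0 ≤ b - a) (hab₁ : b - a ≤ 1)
    (hp : p = 2 * (N : ℝ) / ((N : ℝ) - 2 + 2 * (b - a))) :
    ∃ C : ℝ, 0 ≤ C ∧ ∀ u : EuclideanSpace ℝ (Fin N) → ℝ, ContDiff ℝ 1 u → HasCompactSupport u →
      tsupport u ⊆ puncturedBall N →
      (∫ x, radialDist ‖x‖ ^ (-b * p) * radialRho ‖x‖ ^ N * |u x| ^ p) ^ (2 / p) ≤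
        C * ∫ x, energyWeight N a ‖x‖ * ‖fderiv ℝ u x‖ ^ 2 := by
  obtain ⟨C₂, hC₂, hSob⟩ := exists_hardySobolev_const_of_punctured hN ha rfl
  set q : ℝ := 2 * N / ((N : ℝ) - 2) with hq
  have hN' : (3 : ℝ) ≤ N := by exact_mod_cast hN
  have hN2 : (0 : ℝ) < N - 2 := by linarith
  have hq0 : 0 < q := by rw [hq]; positivity
  have hden : 0 < (N : ℝ) - 2 + 2 * (b - a) := by linarith
  have hp0 : 0 < p := by rw [hp]; positivity
  set t := b - a with ht
  -- The Hölder exponent is forced by matching the powers of `u` (`hpθ`) and of `d` (`hbθ`). After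
  -- raising to `2/p`, the Hardy and Sobolev bounds enter with powers `t` and `1 - t`, so the energy
  -- appears to the first power.
  set θ := t * p / 2 with hθ
  have hθ0 : 0 ≤ θ := by positivity
  have hθ1 : 0 ≤ 1 - θ := by
    have : 1 - θ = ((N : ℝ) - 2) * (1 - t) / ((N : ℝ) - 2 + 2 * t) := by
      rw [hθ, hp]; field_simp; ring
    rw [this]
    have : 0 ≤ 1 - t := by linarith
    positivity
  have hpθ : 2 * θ + q * (1 - θ) = p := by
    rw [hθ, hq, hp]; field_simp; ring
  have hbθ : (-2 * a + -2) * θ + -a * q * (1 - θ) = -b * p := by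
    have hb : b = a + t := by rw [ht]; ring
    rw [hb, ← hpθ]
    have : t * p = 2 * θ := by rw [hθ]; ring
    have : t * (2 * θ + q * (1 - θ)) = 2 * θ := by rw [hpθ, this]
    linarith
  have hqp : (1 - θ) * (2 / p) = 2 / q * (1 - t) := by
    rw [hθ, hq, hp]; field_simp; ring
  have htp : θ * (2 / p) = t := by rw [hθ]; field_simp
  set c := (N : ℝ) - 2 - 2 * max a 0
  set C₁ := 4 / c ^ 2
  have hC₁ : 0 ≤ C₁ := by positivity
  refine ⟨C₁ ^ t * C₂ ^ (1 - t), by positivity, fun u hu hc hs => ?_⟩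
  set E := ∫ x, energyWeight N a ‖x‖ * ‖fderiv ℝ u x‖ ^ 2
  have hE0 : 0 ≤ E := by
    refine integral_nonneg fun x => ?_
    by_cases hx : x ∈ tsupport u
    · obtain ⟨hx0, hx1⟩ := hs hx
      have := energyWeight_nonneg (N := N) (a := a) hx0.le hx1
      simp only [Pi.zero_apply]
      positivity
    · have h1 : fderiv ℝ u x = 0 :=
        image_eq_zero_of_notMem_tsupport fun h => hx (tsupport_fderiv_subset ℝ h)
      simp [h1]
  have hInt (s : ℝ) {k : ℝ} (hk : 0 < k) :
      Integrable fun x => radialDist ‖x‖ ^ s * radialRho ‖x‖ ^ N * |u x| ^ k :=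
    integrable_radial_mul (continuousOn_radialDist_rpow_mul (N := N) s)
      (hu.continuous.abs.rpow_const fun x => Or.inr hk.le)
      (hc.comp_left (g := fun y : ℝ => |y| ^ k) (by simp [Real.zero_rpow hk.ne']))
      ((tsupport_abs_rpow_subset hk).trans hs)
  have hnn (s : ℝ) {k : ℝ} (hk : 0 < k) :
      0 ≤ fun x => radialDist ‖x‖ ^ s * radialRho ‖x‖ ^ N * |u x| ^ k := by
    intro x
    by_cases hx : x ∈ tsupport u
    · obtain ⟨hx0, hx1⟩ := hs hx
      have := radialDist_pos hx0 hx1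
      have := radialRho_pos hx0.le hx1
      simp only [Pi.zero_apply]
      positivity
    · simp [image_eq_zero_of_notMem_tsupport hx, Real.zero_rpow hk.ne']
  have hX : ∫ x, radialDist ‖x‖ ^ (-2 * a + -2) * radialRho ‖x‖ ^ N * |u x| ^ (2 : ℝ) ≤ C₁ * E := by
    refine (integral_mono (hInt _ two_pos) (integrable_hardyWeight (a := a) hu hc hs)
      fun x => ?_).trans (hardy_inequality_of_punctured ha hu hc hs)
    by_cases hx : x ∈ tsupport u
    · obtain ⟨hx0, hx1⟩ := hs hx
      have hD := radialDist_pos hx0 hx1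
      have := radialRho_pos hx0.le hx1
      have hK := inv_radialDist_le_radialCoth hx0 hx1
      simp only [hardyWeight]
      rw [Real.rpow_ofNat, sq_abs, Real.rpow_add hD]
      have : radialDist ‖x‖ ^ (-2 : ℝ) = ((radialDist ‖x‖)⁻¹) ^ 2 := by
        rw [Real.rpow_neg hD.le, inv_pow, Real.rpow_ofNat]
      rw [this]
      calc _ = radialDist ‖x‖ ^ (-2 * a) * radialRho ‖x‖ ^ N * (radialDist ‖x‖)⁻¹ ^ 2 * u x ^ 2 := by
            ring
        _ ≤ _ := by gcongr
    · simp [image_eq_zero_of_notMem_tsupport hx]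
  have hY := hSob u hu hc hs
  have hZ : ∫ x, radialDist ‖x‖ ^ (-b * p) * radialRho ‖x‖ ^ N * |u x| ^ p ≤
      (∫ x, radialDist ‖x‖ ^ (-2 * a + -2) * radialRho ‖x‖ ^ N * |u x| ^ (2 : ℝ)) ^ θ *
      (∫ x, radialDist ‖x‖ ^ (-a * q) * radialRho ‖x‖ ^ N * |u x| ^ q) ^ (1 - θ) := by
    refine le_trans (le_of_eq (integral_congr_ae (Eventually.of_forall fun x => ?_)))
      (integral_rpow_mul_rpow_le (hInt (-2 * a + -2) two_pos) (hInt (-a * q) hq0)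
        (hnn _ two_pos) (hnn _ hq0) hθ0 hθ1 (by ring))
    simp only
    by_cases hx : u x = 0
    · rw [hx, abs_zero, Real.zero_rpow hp0.ne', Real.zero_rpow two_ne_zero, Real.zero_rpow hq0.ne',
        mul_zero, mul_zero, mul_zero]
      -- If `θ = 0` the first factor is `0 ^ 0 = 1`, and the second one vanishes instead.
      rcases hθ0.eq_or_lt with h | h
      · rw [← h]; simp
      · simp [Real.zero_rpow h.ne']
    · obtain ⟨hx0, hx1⟩ := hs (subset_tsupport u hx)
      have hD := radialDist_pos hx0 hx1
      have hR := radialRho_pos hx0.le hx1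
      have hU := abs_pos.2 hx
      rw [Real.mul_rpow (by positivity) (by positivity), Real.mul_rpow (by positivity)
        (by positivity), Real.mul_rpow (by positivity) (by positivity),
        Real.mul_rpow (by positivity) (by positivity), ← Real.rpow_mul hD.le, ← Real.rpow_mul hD.le,
        ← Real.rpow_mul hU.le, ← Real.rpow_mul hU.le, ← hpθ, Real.rpow_add hU, hpθ, ← hbθ,
        Real.rpow_add hD]
      have : radialRho ‖x‖ ^ N = (radialRho ‖x‖ ^ N) ^ θ * (radialRho ‖x‖ ^ N) ^ (1 - θ) := by
        rw [← Real.rpow_add (by positivity), add_sub_cancel, Real.rpow_one]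
      conv_lhs => rw [this]
      ring
  set X := ∫ x, radialDist ‖x‖ ^ (-2 * a + -2) * radialRho ‖x‖ ^ N * |u x| ^ (2 : ℝ)
  set Y := ∫ x, radialDist ‖x‖ ^ (-a * q) * radialRho ‖x‖ ^ N * |u x| ^ q
  have hX0 : 0 ≤ X := integral_nonneg (hnn _ two_pos)
  have hY0 : 0 ≤ Y := integral_nonneg (hnn _ hq0)
  have h1t : 0 ≤ 1 - t := by linarith
  calc _ ≤ (X ^ θ * Y ^ (1 - θ)) ^ (2 / p) :=
        Real.rpow_le_rpow (integral_nonneg (hnn _ hp0)) hZ (by positivity)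
    _ = X ^ t * (Y ^ (2 / q)) ^ (1 - t) := by
        rw [Real.mul_rpow (by positivity) (by positivity), ← Real.rpow_mul hX0,
          ← Real.rpow_mul hY0, ← Real.rpow_mul hY0, htp, hqp]
    _ ≤ (C₁ * E) ^ t * (C₂ * E) ^ (1 - t) := by gcongr
    _ = C₁ ^ t * C₂ ^ (1 - t) * (E ^ t * E ^ (1 - t)) := by
        rw [Real.mul_rpow hC₁ hE0, Real.mul_rpow hC₂ hE0]; ring
    _ = _ := by
        rw [← Real.rpow_add_of_nonneg hE0 hab₀ h1t, add_sub_cancel, Real.rpow_one]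

end Interpolation

/-! ### Integrability of powers of the distance at the origin. -/

section SingularWeights

variable {N : ℕ}

lemma norm_lt_one_of_mem {x : EuclideanSpace ℝ (Fin N)} (hx : x ∈ ball N) : ‖x‖ < 1 := by
  simpa [ball] using hx

lemma continuous_mul_of_tsupport_subset_ball {φ : ℝ → ℝ} (hφ : ContinuousOn φ (Ico 0 1))
    {f : EuclideanSpace ℝ (Fin N) → ℝ} (hf : Continuous f) (hs : tsupport f ⊆ ball N) :
    Continuous fun x => φ ‖x‖ * f x := by
  refine continuous_of_tsupport fun x hx => ?_
  have hx' : x ∈ ball N := hs (tsupport_mul_subset_right hx)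
  have hb : IsOpen (ball N) := Metric.isOpen_ball
  have h : ContinuousOn (fun y : EuclideanSpace ℝ (Fin N) => φ ‖y‖) (ball N) :=
    hφ.comp continuous_norm.continuousOn fun y hy => ⟨norm_nonneg y, norm_lt_one_of_mem hy⟩
  exact (h.continuousAt (hb.mem_nhds hx')).mul hf.continuousAt

lemma continuousOn_radialDist : ContinuousOn radialDist (Ico 0 1) := fun _ hr =>
  (hasDerivAt_radialDist hr.1 hr.2).continuousAt.continuousWithinAt

lemma continuousOn_radialRho : ContinuousOn radialRho (Ico 0 1) := fun _ hr =>
  (hasDerivAt_radialRho hr.1 hr.2).continuousAt.continuousWithinAt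

lemma measurable_radialDist : Measurable radialDist := by
  unfold radialDist
  fun_prop

lemma measurable_radialRho : Measurable radialRho := by
  unfold radialRho
  fun_prop

/-- Powers of the distance above the critical exponent are integrable against compactly supported
functions. -/
lemma integrable_radialDist_rpow_mul (hN : 1 ≤ N) {s : ℝ} (hsN : -(N : ℝ) < s)
    {f : EuclideanSpace ℝ (Fin N) → ℝ} (hf : Continuous f) (hc : HasCompactSupport f)
    (hs : tsupport f ⊆ ball N) : Integrable fun x => radialDist ‖x‖ ^ s * f x := by
  rcases le_or_gt 0 s with h0 | h0
  · refine (continuous_mul_of_tsupport_subset_ball (φ := fun r => radialDist r ^ s)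
      (continuousOn_radialDist.rpow_const fun _ _ => Or.inr h0) hf hs).integrable_of_hasCompactSupport
      hc.mul_left
  · obtain ⟨C, hC⟩ := hc.exists_bound_of_continuous hf
    have hC0 : 0 ≤ C := (norm_nonneg _).trans (hC 0)
    have hm : AEStronglyMeasurable (fun x : EuclideanSpace ℝ (Fin N) => radialDist ‖x‖ ^ s * f x)
        volume :=
      (((measurable_radialDist.comp measurable_norm).pow_const s).mul
        hf.measurable).aestronglyMeasurable
    have hloc := locallyIntegrable_of_norm_le_rpow
      (μ := (volume : Measure (EuclideanSpace ℝ (Fin N)))) (C := C) (α := -s) (by simpa using hN)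
      (by simp only [finrank_euclideanSpace, Fintype.card_fin]; linarith)
      (Eventually.of_forall fun x => ?_) hm
    · rw [← integrableOn_iff_integrable_of_support_subset (s := tsupport f)
        ((Function.support_mul_subset_right _ _).trans (subset_tsupport f))]
      exact hloc.integrableOn_isCompact hc
    · by_cases hx : x ∈ tsupport f
      · have h1 := norm_lt_one_of_mem (hs hx)
        rw [neg_neg, norm_mul, mul_comm]
        refine mul_le_mul (hC x) ?_ (norm_nonneg _) hC0
        rw [Real.norm_of_nonneg (Real.rpow_nonneg (radialDist_nonneg (norm_nonneg x) h1) _)]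
        -- At the origin both sides are the same power of `0`; elsewhere `d ≥ 2‖x‖ ≥ ‖x‖` and the
        -- exponent is negative.
        rcases (norm_nonneg x).eq_or_lt with hx0 | hx0
        · rw [← hx0]
          simp [radialDist]
        · refine Real.rpow_le_rpow_of_nonpos hx0 ?_ h0.le
          linarith [two_mul_le_radialDist hx0.le h1]
      · rw [image_eq_zero_of_notMem_tsupport hx, mul_zero, norm_zero]
        positivity

end SingularWeights

/-! ### Cutoff functions at scale `1/(n+1)`. -/

section Cutoff

variable {N : ℕ}

/-- A fixed bump function at the origin. -/
def originBump (N : ℕ) : ContDiffBump (0 : EuclideanSpace ℝ (Fin N)) := ⟨1, 2, one_pos, one_lt_two⟩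

/-- A cutoff function vanishing near the origin and equal to one outside a small ball. -/
def cutoff (n : ℕ) (x : EuclideanSpace ℝ (Fin N)) : ℝ := 1 - originBump N (((n : ℝ) + 1) • x)

lemma contDiff_cutoff (n : ℕ) : ContDiff ℝ 1 (cutoff (N := N) n) :=
  contDiff_const.sub ((originBump N).contDiff.comp (contDiff_id.const_smul ((n : ℝ) + 1)))

lemma cutoff_nonneg (n : ℕ) (x : EuclideanSpace ℝ (Fin N)) : 0 ≤ cutoff n x :=
  sub_nonneg.2 (originBump N).le_one

lemma cutoff_le_one (n : ℕ) (x : EuclideanSpace ℝ (Fin N)) : cutoff n x ≤ 1 :=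
  sub_le_self _ (originBump N).nonneg

lemma norm_smul_cast_succ (n : ℕ) (x : EuclideanSpace ℝ (Fin N)) :
    ‖((n : ℝ) + 1) • x‖ = ((n : ℝ) + 1) * ‖x‖ := by
  rw [norm_smul, Real.norm_of_nonneg (by positivity)]

lemma cutoff_eq_zero {n : ℕ} {x : EuclideanSpace ℝ (Fin N)} (hx : ((n : ℝ) + 1) * ‖x‖ ≤ 1) :
    cutoff n x = 0 := by
  rw [cutoff, (originBump N).one_of_mem_closedBall, sub_self]
  rw [mem_closedBall_zero_iff, norm_smul_cast_succ]
  exact hx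

lemma cutoff_eq_one {n : ℕ} {x : EuclideanSpace ℝ (Fin N)} (hx : 2 ≤ ((n : ℝ) + 1) * ‖x‖) :
    cutoff n x = 1 := by
  rw [cutoff, (originBump N).zero_of_le_dist, sub_zero]
  rw [dist_zero_right, norm_smul_cast_succ]
  exact hx

lemma fderiv_cutoff_eq_zero {n : ℕ} {x : EuclideanSpace ℝ (Fin N)}
    (hx : 2 < ((n : ℝ) + 1) * ‖x‖) : fderiv ℝ (cutoff n) x = 0 := by
  have h : cutoff n =ᶠ[𝓝 x] fun _ => (1 : ℝ) := by
    have : IsOpen {y : EuclideanSpace ℝ (Fin N) | 2 < ((n : ℝ) + 1) * ‖y‖} :=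
      isOpen_lt continuous_const (by fun_prop)
    filter_upwards [this.mem_nhds hx] with y hy
    exact cutoff_eq_one (le_of_lt hy)
  rw [h.fderiv_eq]
  simp

/-- Scale invariance: the gradient is at most `B (n+1)` and vanishes where `(n+1)‖x‖ > 2`, so the
bound is uniform in `n`. -/
lemma exists_norm_mul_norm_fderiv_cutoff_le :
    ∃ B : ℝ, ∀ (n : ℕ) (x : EuclideanSpace ℝ (Fin N)), ‖x‖ * ‖fderiv ℝ (cutoff n) x‖ ≤ B := by
  have hcd : ContDiff ℝ 1 (originBump N) := (originBump N).contDiff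
  obtain ⟨B, hB⟩ := ((originBump N).hasCompactSupport.fderiv ℝ).exists_bound_of_continuous
    (hcd.continuous_fderiv one_ne_zero)
  have hB0 : 0 ≤ B := (norm_nonneg _).trans (hB 0)
  refine ⟨2 * B, fun n x => ?_⟩
  rcases lt_or_ge 2 (((n : ℝ) + 1) * ‖x‖) with hx | hx
  · rw [fderiv_cutoff_eq_zero hx, norm_zero, mul_zero]
    positivity
  · have hd : HasFDerivAt (cutoff n) (-((fderiv ℝ (originBump N) (((n : ℝ) + 1) • x)).comp
        (((n : ℝ) + 1) • ContinuousLinearMap.id ℝ (EuclideanSpace ℝ (Fin N))))) x := by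
      have h1 := (hcd.differentiable one_ne_zero (((n : ℝ) + 1) • x)).hasFDerivAt
      have h2 := (hasFDerivAt_id (𝕜 := ℝ) x).const_smul ((n : ℝ) + 1)
      exact (HasFDerivAt.comp x h1 h2).const_sub 1
    rw [hd.fderiv, norm_neg]
    have : ‖(fderiv ℝ (originBump N) (((n : ℝ) + 1) • x)).comp
        (((n : ℝ) + 1) • ContinuousLinearMap.id ℝ (EuclideanSpace ℝ (Fin N)))‖ ≤
        B * ((n : ℝ) + 1) := by
      rw [ContinuousLinearMap.comp_smul, ContinuousLinearMap.comp_id, norm_smul,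
        Real.norm_of_nonneg (by positivity), mul_comm]
      gcongr
      exact hB _
    calc _ ≤ ‖x‖ * (B * ((n : ℝ) + 1)) := by gcongr
      _ = (((n : ℝ) + 1) * ‖x‖) * B := by ring
      _ ≤ 2 * B := by gcongr

lemma tsupport_cutoff_mul_subset {u : EuclideanSpace ℝ (Fin N) → ℝ} (hs : tsupport u ⊆ ball N)
    (n : ℕ) : tsupport (fun x => cutoff n x * u x) ⊆ puncturedBall N := by
  intro x hx
  refine ⟨?_, norm_lt_one_of_mem (hs (tsupport_mul_subset_right hx))⟩
  have hcl : IsClosed {y : EuclideanSpace ℝ (Fin N) | 1 ≤ ((n : ℝ) + 1) * ‖y‖} :=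
    isClosed_le continuous_const (by fun_prop)
  have hsub : tsupport (fun x => cutoff n x * u x) ⊆
      {y : EuclideanSpace ℝ (Fin N) | 1 ≤ ((n : ℝ) + 1) * ‖y‖} := by
    refine closure_minimal (fun y hy => ?_) hcl
    by_contra h
    simp only [mem_ofPred_eq, not_le] at h
    exact hy (by simp [cutoff_eq_zero h.le])
  have h1 : 1 ≤ ((n : ℝ) + 1) * ‖x‖ := hsub hx
  by_contra h
  have : ‖x‖ = 0 := le_antisymm (not_lt.1 h) (norm_nonneg x)
  rw [this] at h1
  norm_num at h1

lemma eventually_two_lt_mul_norm {x : EuclideanSpace ℝ (Fin N)} (hx : x ≠ 0) :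
    ∀ᶠ n : ℕ in atTop, 2 < ((n : ℝ) + 1) * ‖x‖ := by
  have hpos : 0 < ‖x‖ := norm_pos_iff.2 hx
  obtain ⟨m, hm⟩ := exists_nat_gt (2 / ‖x‖)
  filter_upwards [eventually_ge_atTop m] with n hn
  have : (m : ℝ) ≤ n := by exact_mod_cast hn
  rw [div_lt_iff₀ hpos] at hm
  nlinarith

end Cutoff

/-! ### Removing the condition at the origin. -/

section Approximation

variable {N : ℕ} {a b p : ℝ} {u : EuclideanSpace ℝ (Fin N) → ℝ}

lemma continuousOn_radialRho_pow_div : ContinuousOn (fun r => radialRho r ^ N / radialRho r ^ 2)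
    (Ico 0 1) :=
  (continuousOn_radialRho.pow N).div (continuousOn_radialRho.pow 2) fun _ hr =>
    (pow_pos (radialRho_pos hr.1 hr.2) 2).ne'

lemma integrable_energy (hN : 3 ≤ N) (ha : a < ((N : ℝ) - 2) / 2) (hu : ContDiff ℝ 1 u)
    (hc : HasCompactSupport u) (hs : tsupport u ⊆ ball N) :
    Integrable fun x => energyWeight N a ‖x‖ * ‖fderiv ℝ u x‖ ^ 2 := by
  have hfd : Continuous (fderiv ℝ u) := hu.continuous_fderiv one_ne_zero
  have hcont : Continuous fun x => radialRho ‖x‖ ^ N / radialRho ‖x‖ ^ 2 * ‖fderiv ℝ u x‖ ^ 2 :=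
    continuous_mul_of_tsupport_subset_ball (φ := fun r => radialRho r ^ N / radialRho r ^ 2)
      continuousOn_radialRho_pow_div (by fun_prop) (tsupport_norm_fderiv_sq_subset.trans hs)
  have h := integrable_radialDist_rpow_mul (N := N) (s := -2 * a) (by omega) (by linarith) hcont
    (((hc.fderiv ℝ).comp_left (g := fun L : EuclideanSpace ℝ (Fin N) →L[ℝ] ℝ => ‖L‖ ^ 2)
      (by simp)).mul_left)
    (tsupport_mul_subset_right.trans (tsupport_norm_fderiv_sq_subset.trans hs))
  refine h.congr (Eventually.of_forall fun x => ?_)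
  simp only [energyWeight]
  ring

lemma integrable_potential (hN : 3 ≤ N) (hp0 : 0 < p) (hbp : b * p < N) (hu : ContDiff ℝ 1 u)
    (hc : HasCompactSupport u) (hs : tsupport u ⊆ ball N) :
    Integrable fun x => radialDist ‖x‖ ^ (-b * p) * radialRho ‖x‖ ^ N * |u x| ^ p := by
  have hsp := (tsupport_abs_rpow_subset (u := u) hp0).trans hs
  have hcont : Continuous fun x => radialRho ‖x‖ ^ N * |u x| ^ p :=
    continuous_mul_of_tsupport_subset_ball (φ := fun r => radialRho r ^ N)
      (continuousOn_radialRho.pow N) (hu.continuous.abs.rpow_const fun x => Or.inr hp0.le) hsp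
  have h := integrable_radialDist_rpow_mul (N := N) (s := -b * p) (by omega) (by linarith) hcont
    ((hc.comp_left (g := fun y : ℝ => |y| ^ p) (by simp [Real.zero_rpow hp0.ne'])).mul_left)
    (tsupport_mul_subset_right.trans hsp)
  refine h.congr (Eventually.of_forall fun x => ?_)
  ring

/-- The error term coming from the gradient of the cutoff functions vanishes in the limit. -/
lemma tendsto_integral_cutoff_error (hN : 3 ≤ N) (ha : a < ((N : ℝ) - 2) / 2)
    (hu : ContDiff ℝ 1 u) (hc : HasCompactSupport u) (hs : tsupport u ⊆ ball N) :
    (∀ n : ℕ, Integrable fun x => energyWeight N a ‖x‖ * (‖fderiv ℝ (cutoff n) x‖ ^ 2 * u x ^ 2)) ∧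
    Tendsto (fun n : ℕ => ∫ x, energyWeight N a ‖x‖ * (‖fderiv ℝ (cutoff n) x‖ ^ 2 * u x ^ 2))
      atTop (𝓝 0) := by
  -- Positive dimension makes the origin a null set.
  have : Nonempty (Fin N) := ⟨⟨0, by omega⟩⟩
  obtain ⟨B, hB⟩ := exists_norm_mul_norm_fderiv_cutoff_le (N := N)
  have h2 : (fun x => u x ^ 2) = fun x => u x * u x := by ext; ring
  have hc2 : HasCompactSupport fun x => u x ^ 2 := by rw [h2]; exact hc.mul_left
  have hs2 : tsupport (fun x => u x ^ 2) ⊆ ball N := by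
    rw [h2]; exact tsupport_mul_subset_right.trans hs
  -- The factor `2/(1-r)` comes from `1/r ≤ 2 / ((1-r) d)`, which trades the cutoff bound `B/‖x‖`
  -- for `1/d`; `φ` stays continuous at the origin.
  set φ : ℝ → ℝ := fun r => B ^ 2 * (2 / (1 - r)) ^ 2 * (radialRho r ^ N / radialRho r ^ 2) with hφ
  have hφc : ContinuousOn φ (Ico 0 1) := by
    refine ContinuousOn.mul (continuousOn_const.mul (ContinuousOn.pow ?_ 2))
      continuousOn_radialRho_pow_div
    exact continuousOn_const.div (by fun_prop) fun r hr => by linarith [hr.2]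
  have hbound := integrable_radialDist_rpow_mul (N := N) (s := -2 * a + -2) (by omega)
    (by linarith) (continuous_mul_of_tsupport_subset_ball hφc (hu.continuous.pow 2) hs2)
    hc2.mul_left (tsupport_mul_subset_right.trans hs2)
  have hmeas (n : ℕ) : AEStronglyMeasurable (fun x : EuclideanSpace ℝ (Fin N) =>
      energyWeight N a ‖x‖ * (‖fderiv ℝ (cutoff n) x‖ ^ 2 * u x ^ 2)) volume := by
    have hfd : Continuous (fderiv ℝ (cutoff (N := N) n)) :=
      (contDiff_cutoff n).continuous_fderiv one_ne_zero
    have hw : Measurable (energyWeight N a) := by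
      unfold energyWeight
      have := measurable_radialDist
      have := measurable_radialRho
      fun_prop
    have hu' := hu.continuous
    have hcont : Continuous fun x => ‖fderiv ℝ (cutoff n) x‖ ^ 2 * u x ^ 2 := by fun_prop
    exact ((hw.comp measurable_norm).mul hcont.measurable).aestronglyMeasurable
  have hne : ∀ᵐ x : EuclideanSpace ℝ (Fin N), x ≠ 0 := by
    simp [ae_iff]
  have hle (n : ℕ) : ∀ᵐ x : EuclideanSpace ℝ (Fin N),
      ‖energyWeight N a ‖x‖ * (‖fderiv ℝ (cutoff n) x‖ ^ 2 * u x ^ 2)‖ ≤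
        radialDist ‖x‖ ^ (-2 * a + -2) * (φ ‖x‖ * u x ^ 2) := by
    filter_upwards [hne] with x hx
    by_cases hxs : x ∈ tsupport u
    · have h1 := norm_lt_one_of_mem (hs hxs)
      have h0 : 0 < ‖x‖ := norm_pos_iff.2 hx
      have hD := radialDist_pos h0 h1
      have hR := radialRho_pos h0.le h1
      have hE := energyWeight_nonneg (N := N) (a := a) h0.le h1
      have h1r : 0 < 1 - ‖x‖ := by linarith
      rw [Real.norm_of_nonneg (by positivity)]
      have hf : ‖fderiv ℝ (cutoff n) x‖ ≤ B * (2 / (1 - ‖x‖)) * (radialDist ‖x‖)⁻¹ := by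
        have hB0 : 0 ≤ B := le_trans (by positivity) (hB n x)
        have hDle := radialDist_le h0.le h1
        have hi : ‖x‖⁻¹ ≤ 2 / (1 - ‖x‖) * (radialDist ‖x‖)⁻¹ := by
          rw [inv_eq_one_div, ← div_eq_mul_inv, div_le_div_iff₀ h0 hD, one_mul]
          calc _ ≤ _ := hDle
            _ = _ := by ring
        calc ‖fderiv ℝ (cutoff n) x‖ = ‖x‖ * ‖fderiv ℝ (cutoff n) x‖ * ‖x‖⁻¹ := by
              field_simp
          _ ≤ B * (2 / (1 - ‖x‖) * (radialDist ‖x‖)⁻¹) := by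
              gcongr
              exact hB n x
          _ = _ := by ring
      have hpow : radialDist ‖x‖ ^ (-2 * a + -2) =
          radialDist ‖x‖ ^ (-2 * a) * (radialDist ‖x‖)⁻¹ ^ 2 := by
        rw [Real.rpow_add hD, Real.rpow_neg hD.le 2, inv_pow, Real.rpow_ofNat]
      rw [hpow]
      calc _ ≤ energyWeight N a ‖x‖ *
            ((B * (2 / (1 - ‖x‖)) * (radialDist ‖x‖)⁻¹) ^ 2 * u x ^ 2) := by gcongr
        _ = _ := by
          simp only [energyWeight, hφ]
          ring
    · simp [image_eq_zero_of_notMem_tsupport hxs]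
  refine ⟨fun n => hbound.mono' (hmeas n) (hle n), ?_⟩
  have h := tendsto_integral_of_dominated_convergence (μ := volume) (f := fun _ => (0 : ℝ)) _
    hmeas hbound hle ?_
  · simpa using h
  · filter_upwards [hne] with x hx
    refine tendsto_const_nhds.congr' ?_
    filter_upwards [eventually_two_lt_mul_norm hx] with n hn
    rw [fderiv_cutoff_eq_zero hn]
    simp

/-- The inequality in Euclidean coordinates, for functions that need not vanish near the origin. -/
theorem exists_const_of_ball (hN : 3 ≤ N) (ha : a < ((N : ℝ) - 2) / 2) (hab₀ : 0 ≤ b - a)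
    (hab₁ : b - a ≤ 1) (hp : p = 2 * (N : ℝ) / ((N : ℝ) - 2 + 2 * (b - a))) (hp0 : 0 < p)
    (hbp : b * p < N) :
    ∃ C : ℝ, 0 ≤ C ∧ ∀ u : EuclideanSpace ℝ (Fin N) → ℝ, ContDiff ℝ 1 u → HasCompactSupport u →
      tsupport u ⊆ ball N →
      (∫ x, radialDist ‖x‖ ^ (-b * p) * radialRho ‖x‖ ^ N * |u x| ^ p) ^ (2 / p) ≤
        C * ∫ x, energyWeight N a ‖x‖ * ‖fderiv ℝ u x‖ ^ 2 := by
  have : Nonempty (Fin N) := ⟨⟨0, by omega⟩⟩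
  have hN' : (3 : ℝ) ≤ N := by exact_mod_cast hN
  have hc0 : 0 < (N : ℝ) - 2 - 2 * max a 0 := by
    rcases max_cases a 0 with h | h <;> rw [h.1] <;> linarith
  obtain ⟨C, hC, hmain⟩ := exists_const_of_punctured hN hc0 hab₀ hab₁ hp
  -- The factor `2` comes from `(s + t)² ≤ 2s² + 2t²` in the product rule for the cutoff; the error
  -- term disappears in the limit.
  refine ⟨C * 2, by positivity, fun u hu hc hs => ?_⟩
  obtain ⟨herr, hlim⟩ := tendsto_integral_cutoff_error hN ha hu hc hs
  have hE := integrable_energy hN ha hu hc hs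
  have hF := integrable_potential hN hp0 hbp hu hc hs
  have hun (n : ℕ) : ContDiff ℝ 1 fun x => cutoff n x * u x := (contDiff_cutoff n).mul hu
  have hne : ∀ᵐ x : EuclideanSpace ℝ (Fin N), x ≠ 0 := by
    simp [ae_iff]
  have hleft : Tendsto (fun n : ℕ => (∫ x, radialDist ‖x‖ ^ (-b * p) * radialRho ‖x‖ ^ N *
      |cutoff n x * u x| ^ p) ^ (2 / p)) atTop
      (𝓝 ((∫ x, radialDist ‖x‖ ^ (-b * p) * radialRho ‖x‖ ^ N * |u x| ^ p) ^ (2 / p))) := by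
    refine Tendsto.rpow_const ?_ (Or.inr (by positivity))
    refine tendsto_integral_of_dominated_convergence _ (fun n => ?_) hF (fun n => ?_) ?_
    · exact (integrable_potential hN hp0 hbp (hun n) hc.mul_left
        (tsupport_mul_subset_right.trans hs)).aestronglyMeasurable
    · refine Eventually.of_forall fun x => ?_
      by_cases hxs : x ∈ tsupport u
      · have h1 := norm_lt_one_of_mem (hs hxs)
        have hD := radialDist_nonneg (norm_nonneg x) h1
        have hR := radialRho_pos (norm_nonneg x) h1
        rw [Real.norm_of_nonneg (by positivity), abs_mul, abs_of_nonneg (cutoff_nonneg n x)]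
        gcongr
        · exact mul_nonneg (cutoff_nonneg n x) (abs_nonneg _)
        · exact mul_le_of_le_one_left (abs_nonneg _) (cutoff_le_one n x)
      · simp [image_eq_zero_of_notMem_tsupport hxs, Real.zero_rpow hp0.ne']
    · filter_upwards [hne] with x hx
      refine tendsto_const_nhds.congr' ?_
      filter_upwards [eventually_two_lt_mul_norm hx] with n hn
      rw [cutoff_eq_one hn.le, one_mul]
  have hright : Tendsto (fun n : ℕ => C * (2 * (∫ x, energyWeight N a ‖x‖ * ‖fderiv ℝ u x‖ ^ 2) +
      2 * ∫ x, energyWeight N a ‖x‖ * (‖fderiv ℝ (cutoff n) x‖ ^ 2 * u x ^ 2))) atTop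
      (𝓝 (C * (2 * (∫ x, energyWeight N a ‖x‖ * ‖fderiv ℝ u x‖ ^ 2) + 2 * 0))) :=
    (tendsto_const_nhds.add (hlim.const_mul 2)).const_mul C
  rw [mul_zero, add_zero, ← mul_assoc] at hright
  refine le_of_tendsto_of_tendsto' hleft hright fun n => ?_
  refine (hmain _ (hun n) hc.mul_left (tsupport_cutoff_mul_subset hs n)).trans ?_
  refine mul_le_mul_of_nonneg_left ?_ hC
  rw [← integral_const_mul, ← integral_const_mul,
    ← integral_add (hE.const_mul 2) ((herr n).const_mul 2)]
  refine integral_mono (integrable_energy hN ha (hun n) hc.mul_left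
    (tsupport_mul_subset_right.trans hs)) ((hE.const_mul 2).add ((herr n).const_mul 2))
    fun x => ?_
  by_cases hxs : x ∈ tsupport u
  · have h1 := norm_lt_one_of_mem (hs hxs)
    have hEn := energyWeight_nonneg (N := N) (a := a) (norm_nonneg x) h1
    have hd : HasFDerivAt (fun y => cutoff n y * u y) _ x :=
      ((contDiff_cutoff n).differentiable one_ne_zero x).hasFDerivAt.mul
        (hu.differentiable one_ne_zero x).hasFDerivAt
    have hle : ‖fderiv ℝ (fun y => cutoff n y * u y) x‖ ≤
        ‖fderiv ℝ u x‖ + |u x| * ‖fderiv ℝ (cutoff n) x‖ := by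
      rw [hd.fderiv]
      refine (norm_add_le _ _).trans ?_
      rw [norm_smul, norm_smul, Real.norm_eq_abs, Real.norm_eq_abs,
        abs_of_nonneg (cutoff_nonneg n x)]
      gcongr
      exact mul_le_of_le_one_left (norm_nonneg _) (cutoff_le_one n x)
    calc _ ≤ energyWeight N a ‖x‖ *
          (2 * (‖fderiv ℝ u x‖ ^ 2 + (|u x| * ‖fderiv ℝ (cutoff n) x‖) ^ 2)) := by
          gcongr
          exact (pow_le_pow_left₀ (norm_nonneg _) hle 2).trans add_sq_le
      _ = _ := by
          rw [mul_pow, sq_abs]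
          ring
  · have h1 : fderiv ℝ u x = 0 :=
      image_eq_zero_of_notMem_tsupport fun h => hxs (tsupport_fderiv_subset ℝ h)
    have h2 : fderiv ℝ (fun y => cutoff n y * u y) x = 0 :=
      image_eq_zero_of_notMem_tsupport fun h => hxs
        (tsupport_mul_subset_right (tsupport_fderiv_subset ℝ h))
    simp [image_eq_zero_of_notMem_tsupport hxs, h1, h2]

end Approximation

/-! ### From Euclidean coordinates back to hyperbolic volume and gradient. -/

section Hyperbolic

variable {N : ℕ} {g : EuclideanSpace ℝ (Fin N) → ℝ}

lemma measurable_rho_pow : Measurable fun x : EuclideanSpace ℝ (Fin N) =>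
    ENNReal.ofReal (rho x ^ N) := by
  unfold rho
  fun_prop

lemma toReal_ofReal_rho_pow {x : EuclideanSpace ℝ (Fin N)} (hx : x ∈ ball N) :
    (ENNReal.ofReal (rho x ^ N)).toReal = radialRho ‖x‖ ^ N :=
  ENNReal.toReal_ofReal (pow_pos (radialRho_pos (norm_nonneg x) (norm_lt_one_of_mem hx)) N).le

lemma measurableSet_ball : MeasurableSet (ball N) := Metric.isOpen_ball.measurableSet

lemma integrable_hypVolume (h : Integrable fun x => radialRho ‖x‖ ^ N * g x) :
    Integrable g (hypVolume N) := by
  rw [hypVolume, integrable_withDensity_iff_integrable_smul' measurable_rho_pow (by simp)]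
  refine (h.integrableOn (s := ball N)).congr_fun (fun x hx => ?_) measurableSet_ball
  simp only [toReal_ofReal_rho_pow hx, smul_eq_mul]

lemma integral_hypVolume (h0 : ∀ x ∉ ball N, g x = 0) :
    ∫ x, g x ∂(hypVolume N) = ∫ x, radialRho ‖x‖ ^ N * g x := by
  rw [hypVolume, integral_withDensity_eq_integral_toReal_smul measurable_rho_pow (by simp),
    ← setIntegral_eq_integral_of_forall_compl_eq_zero (s := ball N)
      (f := fun x => radialRho ‖x‖ ^ N * g x) (fun x hx => by rw [h0 x hx, mul_zero])]
  refine setIntegral_congr_fun measurableSet_ball fun x hx => ?_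
  simp only [toReal_ofReal_rho_pow hx, smul_eq_mul]

lemma norm_hypGradient_sq {u : EuclideanSpace ℝ (Fin N) → ℝ} (x : EuclideanSpace ℝ (Fin N)) :
    ‖hypGradient u x‖ ^ 2 = ‖fderiv ℝ u x‖ ^ 2 / radialRho ‖x‖ ^ 2 := by
  rw [hypGradient, norm_smul, mul_pow, gradient, LinearIsometryEquiv.norm_map, Real.norm_eq_abs,
    sq_abs, inv_pow, mul_comm, ← div_eq_mul_inv]
  rfl

end Hyperbolic

end

end PoincareBall

open PoincareBall MeasureTheory

theorem theorem1p1 (N : ℕ) (hN : 3 ≤ N) (a b p : ℝ)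
    (ha : a < ((N : ℝ) - 2) / 2) (hab₀ : 0 ≤ b - a) (hab₁ : b - a ≤ 1)
    (hp : p = 2 * (N : ℝ) / ((N : ℝ) - 2 + 2 * (b - a))) :
    ∃ C : ℝ, 0 < C ∧
      ∀ u : EuclideanSpace ℝ (Fin N) → ℝ, PoincareBall.IsTestFunction u →
        MeasureTheory.Integrable
          (fun x => PoincareBall.d x ^ (-b * p) * |u x| ^ p) (PoincareBall.hypVolume N) ∧
        MeasureTheory.Integrable
          (fun x => PoincareBall.d x ^ (-2 * a) * ‖PoincareBall.hypGradient u x‖ ^ 2)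
          (PoincareBall.hypVolume N) ∧
        (∫ x, PoincareBall.d x ^ (-b * p) * |u x| ^ p ∂(PoincareBall.hypVolume N)) ^ (2 / p) ≤
          C * ∫ x, PoincareBall.d x ^ (-2 * a) * ‖PoincareBall.hypGradient u x‖ ^ 2
            ∂(PoincareBall.hypVolume N) := by
  have hN' : (3 : ℝ) ≤ N := by exact_mod_cast hN
  have hden : 0 < (N : ℝ) - 2 + 2 * (b - a) := by linarith
  have hp0 : 0 < p := by rw [hp]; positivity
  -- Clearing the denominator of `p`, this is equivalent to `2a < N - 2`; it makes `d^{-bp}` locally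
  -- integrable.
  have hbp : b * p < N := by
    rw [hp, ← mul_div_assoc, div_lt_iff₀ hden]
    nlinarith
  obtain ⟨C, hC, hmain⟩ := exists_const_of_ball hN ha hab₀ hab₁ hp hp0 hbp
  -- Adding `1` makes the nonnegative constant strictly positive.
  refine ⟨C + 1, by positivity, fun u hu => ?_⟩
  have hu1 : ContDiff ℝ 1 u := hu.smooth.of_le (by simp)
  have hs := hu.support_subset
  have hE := integrable_energy hN ha hu1 hu.compact_support hs
  have hF := integrable_potential hN hp0 hbp hu1 hu.compact_support hs
  have hu0 (x) (hx : x ∉ ball N) : u x = 0 :=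
    image_eq_zero_of_notMem_tsupport fun h => hx (hs h)
  have hdu0 (x) (hx : x ∉ ball N) : fderiv ℝ u x = 0 :=
    image_eq_zero_of_notMem_tsupport fun h => hx (hs (tsupport_fderiv_subset ℝ h))
  have eF (x) : radialRho ‖x‖ ^ N * (d x ^ (-b * p) * |u x| ^ p) =
      radialDist ‖x‖ ^ (-b * p) * radialRho ‖x‖ ^ N * |u x| ^ p := by
    by_cases hx : x ∈ ball N
    · rw [d_eq_log hx, radialDist]
      ring
    · simp [hu0 x hx, Real.zero_rpow hp0.ne']
  have eE (x) : radialRho ‖x‖ ^ N * (d x ^ (-2 * a) * ‖hypGradient u x‖ ^ 2) =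
      energyWeight N a ‖x‖ * ‖fderiv ℝ u x‖ ^ 2 := by
    rw [norm_hypGradient_sq]
    by_cases hx : x ∈ ball N
    · rw [d_eq_log hx, energyWeight, radialDist]
      ring
    · simp [hdu0 x hx]
  refine ⟨integrable_hypVolume (by simpa only [eF] using hF),
    integrable_hypVolume (by simpa only [eE] using hE), ?_⟩
  rw [integral_hypVolume fun x hx => by simp [hu0 x hx, Real.zero_rpow hp0.ne'],
    integral_hypVolume fun x hx => by simp [norm_hypGradient_sq, hdu0 x hx]]
  simp only [eF, eE]
  refine (hmain u hu1 hu.compact_support hs).trans ?_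
  refine mul_le_mul_of_nonneg_right (by linarith) (integral_nonneg fun x => ?_)
  by_cases hx : x ∈ ball N
  · exact mul_nonneg (energyWeight_nonneg (norm_nonneg x) (norm_lt_one_of_mem hx)) (sq_nonneg _)
  · simp [hdu0 x hx]
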